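/- Let $n\ge 1$, let $0<\mu_1\le\dots\le\mu_n$ be real numbers and put $\mu=\sum_{i=1}^n\mu_i$. Let $\Gamma$ be a lattice in $\mathbb{R}^n$, acting by translations, let $\mathbb{T}^n=\mathbb{R}^n/\Gamma$ be the corresponding flat torus, and let $X=(\mathbb{R}_+\times\mathbb{R}^n)/\Gamma=\mathbb{R}_+\times\mathbb{T}^n$, where $\Gamma$ acts on the factor $\mathbb{R}^n$, with the Riemannian metric $dt^2+\sum_{i=1}^n e^{2\mu_i t}dx_i^2$. For $R>0$ let $B(R)$ be the ball $\{0<t<R\}=(0,R)\times\mathbb{T}^n$ of $X$ (the points at distance less than $R$ from the boundary torus $\{t=0\}$). For $1\le p<\infty$ and $M=B(R)$ or $M=\mathbb{T}^n$, the $L^p$-Poincaré constant $C_p(M)\in[0,\infty]$ is the infimum of all $C$ such that for every $C^1$ function $f:M\to\mathbb{R}$ there is a real number $m_f$ with $\|f-m_f\|_{L^p(M)}\le C\,\|\nabla f\|_{L^p(M)}$, where the gradient, its length and the volume are those of the Riemannian metric of $M$. Then $C_p(\mathbb{T}^n)<\infty$, and $$C_p(B(R))\le \frac{p}{\mu}+A(\mu)^{1/p}\,C_p(\mathbb{T}^n)\,e^{\mu_n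 R},$$ where $A(\mu)>0$ is a constant depending only on $\mu$ (and not on $n$, on $\Gamma$, on $p$, on $R$, or otherwise on the $\mu_i$). -/

import Mathlib

open MeasureTheory
open scoped ENNReal

noncomputable section

/-- The lift to the cover `ℝⁿ` of a function on the flat torus `ℝⁿ / Γ`. -/
def torusLift {n : ℕ} (Γ : Submodule ℤ (EuclideanSpace ℝ (Fin n)))
    (f : (EuclideanSpace ℝ (Fin n) ⧸ Γ) → ℝ) : EuclideanSpace ℝ (Fin n) → ℝ :=
  fun x => f (Submodule.Quotient.mk x)

/-- The `L^p` Poincaré constant of the flat torus `ℝⁿ / Γ`: the best constant `C` such that every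
`C¹` function `f` on the torus has a real number `m` with `‖f - m‖_p ≤ C ‖∇f‖_p` (and `∞` if there
is no such constant). Integrals over the torus are computed on a fundamental domain `D` of `Γ`. -/
def torusPoincareConst {n : ℕ} (Γ : Submodule ℤ (EuclideanSpace ℝ (Fin n)))
    (D : Set (EuclideanSpace ℝ (Fin n))) (p : ℝ) : ℝ≥0∞ :=
  sInf {C : ℝ≥0∞ | ∀ f : (EuclideanSpace ℝ (Fin n) ⧸ Γ) → ℝ, ContDiff ℝ 1 (torusLift Γ f) →
    ∃ m : ℝ,
      eLpNorm (fun x => torusLift Γ f x - m) (ENNReal.ofReal p) (volume.restrict D) ≤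
        C * eLpNorm (fun x => ‖gradient (torusLift Γ f) x‖) (ENNReal.ofReal p)
          (volume.restrict D)}

/-- The Riemannian metric `dt² + ∑ e^{2 μ_i t} dx_i²` on `ℝ × ℝⁿ`, at a point of height `t`,
as a bilinear form on tangent vectors. -/
def expMetric {n : ℕ} (μ : Fin n → ℝ) (t : ℝ) (v w : ℝ × EuclideanSpace ℝ (Fin n)) : ℝ :=
  v.1 * w.1 + ∑ i, Real.exp (2 * μ i * t) * (v.2 i * w.2 i)

/-- The gradient of `f` with respect to the metric `dt² + ∑ e^{2 μ_i t} dx_i²`; see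
`expMetric_expGradient`. -/
def expGradient {n : ℕ} (μ : Fin n → ℝ) (f : ℝ × EuclideanSpace ℝ (Fin n) → ℝ)
    (z : ℝ × EuclideanSpace ℝ (Fin n)) : ℝ × EuclideanSpace ℝ (Fin n) :=
  (fderiv ℝ f z (1, 0),
    WithLp.toLp 2 fun i =>
      Real.exp (-(2 * μ i * z.1)) * fderiv ℝ f z (0, EuclideanSpace.single i 1))

/-- The defining property of the Riemannian gradient: `g(∇f, v) = df(v)`. -/
theorem expMetric_expGradient {n : ℕ} (μ : Fin n → ℝ) (f : ℝ × EuclideanSpace ℝ (Fin n) → ℝ)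
    (z v : ℝ × EuclideanSpace ℝ (Fin n)) :
    expMetric μ z.1 (expGradient μ f z) v = fderiv ℝ f z v := by
  have hv : v = v.1 • ((1 : ℝ), (0 : EuclideanSpace ℝ (Fin n))) +
      ∑ i, v.2 i • ((0 : ℝ), EuclideanSpace.single i (1 : ℝ)) := by
    refine Prod.ext ?_ ?_
    · simp [Prod.fst_sum]
    · ext j
      simp [Prod.snd_sum, Finset.sum_apply, Pi.single_apply]
  conv_rhs => rw [hv]
  rw [map_add, map_smul, map_sum]
  simp only [map_smul, smul_eq_mul, expMetric, expGradient]
  congr 1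
  · ring
  · refine Finset.sum_congr rfl fun i _ => ?_
    have h : Real.exp (2 * μ i * z.1) * Real.exp (-(2 * μ i * z.1)) = 1 := by
      rw [← Real.exp_add]; simp
    linear_combination (fderiv ℝ f z (0, EuclideanSpace.single i 1)) * v.2 i * h

/-- The length `|∇f|` of the gradient in the metric `dt² + ∑ e^{2 μ_i t} dx_i²`. -/
def expGradientNorm {n : ℕ} (μ : Fin n → ℝ) (f : ℝ × EuclideanSpace ℝ (Fin n) → ℝ)
    (z : ℝ × EuclideanSpace ℝ (Fin n)) : ℝ :=
  Real.sqrt (expMetric μ z.1 (expGradient μ f z) (expGradient μ f z))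

/-- The Riemannian volume of `dt² + ∑ e^{2 μ_i t} dx_i²` on the piece `(0, R) × D` of `ℝ × ℝⁿ`:
the square root of the determinant of the metric is `∏ e^{μ_i t} = e^{(∑ μ_i) t}`. -/
def expVolume {n : ℕ} (μ : Fin n → ℝ) (R : ℝ) (D : Set (EuclideanSpace ℝ (Fin n))) :
    Measure (ℝ × EuclideanSpace ℝ (Fin n)) :=
  (volume.restrict (Set.Ioo 0 R ×ˢ D)).withDensity
    fun z => ENNReal.ofReal (Real.exp ((∑ i, μ i) * z.1))

/-- The lift to the cover `ℝ × ℝⁿ` of a function on `ℝ × (ℝⁿ / Γ)`. -/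
def expLift {n : ℕ} (Γ : Submodule ℤ (EuclideanSpace ℝ (Fin n)))
    (f : ℝ × (EuclideanSpace ℝ (Fin n) ⧸ Γ) → ℝ) : ℝ × EuclideanSpace ℝ (Fin n) → ℝ :=
  fun z => f (z.1, Submodule.Quotient.mk z.2)

/-- The `L^p` Poincaré constant of the ball `B(R)`, the part `0 < t < R` of
`(ℝ_+ × ℝⁿ) / Γ = ℝ_+ × (ℝⁿ / Γ)` with the metric `dt² + ∑ e^{2 μ_i t} dx_i²`: the best constant
`C` such that every `C¹` function `f` on `B(R)` has a real number `m` with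
`‖f - m‖_p ≤ C ‖∇f‖_p` (and `∞` if there is no such constant). Only the values of `f` at heights
`0 < t < R` matter, and nothing is asked of `f` at the boundary. Integrals over the quotient are
computed on a fundamental domain `D` of `Γ`. -/
def expBallPoincareConst {n : ℕ} (μ : Fin n → ℝ) (Γ : Submodule ℤ (EuclideanSpace ℝ (Fin n)))
    (D : Set (EuclideanSpace ℝ (Fin n))) (p R : ℝ) : ℝ≥0∞ :=
  sInf {C : ℝ≥0∞ | ∀ f : ℝ × (EuclideanSpace ℝ (Fin n) ⧸ Γ) → ℝ,
    ContDiffOn ℝ 1 (expLift Γ f) (Set.Ioo 0 R ×ˢ Set.univ) →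
    ∃ m : ℝ,
      eLpNorm (fun z => expLift Γ f z - m) (ENNReal.ofReal p) (expVolume μ R D) ≤
        C * eLpNorm (expGradientNorm μ (expLift Γ f)) (ENNReal.ofReal p) (expVolume μ R D)}

end

/-! Put m = ∑ μ_i. Fix a height r and split f - c = (f - f(r,·)) + (f(r,·) - c), then apply
Minkowski. The first term is handled on each vertical line by a one-dimensional Hardy inequality
with weight e^{mt} (`lintegral_enorm_sub_rpow_mul_exp_le`). Its constant p/m does not depend on R,
because the weight grows towards r from below, while above r only a length of at most 1/(2m)
remains. The second term is handled by the Poincaré inequality of the torus on the slice at height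
r, with c the constant it provides. The height r is chosen by a mean value argument in the top slab
of thickness 1/(2m), so that the horizontal energy of the slice, times the total weight, is at most
3 times the horizontal energy of the ball (`exists_height_mul_lintegral_exp_le`). This gives A = 3.
The factor e^{μ_n R} compares Euclidean and Riemannian lengths of gradients. Finiteness on the torus
follows by averaging over pairs of points of a bounded fundamental domain. -/

/-! ### Weighted Hardy inequality on an interval -/

/-- Hölder's inequality, in the form of comparing the L^1 and L^p norms of g for the measure w·ν. -/
theorem rpow_lintegral_mul_le {α : Type*} [MeasurableSpace α] {ν : Measure α} {p : ℝ} (hp : 1 ≤ p)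
    {w g : α → ℝ≥0∞} (hw : Measurable w) (hg : Measurable g) :
    (∫⁻ x, w x * g x ∂ν) ^ p ≤ (∫⁻ x, w x ∂ν) ^ (p - 1) * ∫⁻ x, w x * g x ^ p ∂ν := by
  have hp0 : 0 < p := by linarith
  have h := eLpNorm'_le_eLpNorm'_mul_rpow_measure_univ (μ := ν.withDensity w) one_pos hp
    (hg.aestronglyMeasurable)
  have h2 := ENNReal.rpow_le_rpow h hp0.le
  simp only [eLpNorm', enorm_eq_self, ENNReal.rpow_one, one_div, inv_one, withDensity_apply _
    MeasurableSet.univ, Measure.restrict_univ] at h2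
  rw [ENNReal.mul_rpow_of_nonneg _ _ hp0.le, ← ENNReal.rpow_mul, ← ENNReal.rpow_mul,
    inv_mul_cancel₀ hp0.ne', ENNReal.rpow_one,
    lintegral_withDensity_eq_lintegral_mul _ hw hg,
    lintegral_withDensity_eq_lintegral_mul _ hw (hg.pow_const p)] at h2
  have e : (1 - p⁻¹) * p = p - 1 := by field_simp
  rw [e] at h2
  simpa only [Pi.mul_apply, mul_comm] using h2

theorem lintegral_exp_neg_mul_sub_Ioi {k : ℝ} (hk : 0 < k) (t : ℝ) :
    ∫⁻ s in Set.Ioi t, ENNReal.ofReal (Real.exp (-(k * (s - t)))) = ENNReal.ofReal (1 / k) := by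
  have hint : IntegrableOn (fun s => Real.exp (-k * s)) (Set.Ioi t) := integrableOn_exp_mul_Ioi (by linarith) t
  have e : ∀ s, Real.exp (-(k * (s - t))) = Real.exp (k * t) * Real.exp (-k * s) := fun s => by
    rw [← Real.exp_add]; ring_nf
  simp_rw [e]
  rw [← ofReal_integral_eq_lintegral_ofReal (hint.const_mul _) (.of_forall fun _ => by positivity),
    integral_const_mul, integral_exp_mul_Ioi (by linarith)]
  congr 1
  have : Real.exp (k * t) * Real.exp (-k * t) = 1 := by rw [← Real.exp_add]; simp
  rw [mul_div_assoc', mul_neg, this, neg_div_neg_eq]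

theorem lintegral_exp_mul_Iic {k : ℝ} (hk : 0 < k) (s : ℝ) :
    ∫⁻ t in Set.Iic s, ENNReal.ofReal (Real.exp (k * t)) =
      ENNReal.ofReal (Real.exp (k * s) / k) := by
  rw [← ofReal_integral_eq_lintegral_ofReal (integrableOn_exp_mul_Iic hk s)
    (.of_forall fun _ => by positivity), integral_exp_mul_Iic hk]

theorem lintegral_exp_neg_mul_sub_Iic {k : ℝ} (hk : 0 < k) (s : ℝ) :
    ∫⁻ t in Set.Iic s, ENNReal.ofReal (Real.exp (-(k * (s - t)))) = ENNReal.ofReal (1 / k) := by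
  have e : ∀ t, ENNReal.ofReal (Real.exp (-(k * (s - t)))) =
      ENNReal.ofReal (Real.exp (-(k * s))) * ENNReal.ofReal (Real.exp (k * t)) := fun t => by
    rw [← ENNReal.ofReal_mul (by positivity), ← Real.exp_add]; ring_nf
  simp_rw [e]
  rw [lintegral_const_mul _ (by fun_prop), lintegral_exp_mul_Iic hk,
    ← ENNReal.ofReal_mul (by positivity), ← mul_div_assoc, ← Real.exp_add]
  simp

-- Hardy's inequality by a Schur test: insert e^{-k(s-t)} e^{k(s-t)} and apply Hölder for the weight
-- e^{-k(s-t)}. The mass of the weight in s gives (1/k)^{p-1}; integrating the remaining weight in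
-- t, after Tonelli, gives the last factor 1/k.
open Set in
theorem lintegral_rpow_lintegral_Icc_mul_exp_le {p m : ℝ} (hp : 1 ≤ p) (hm : 0 < m)
    {h : ℝ → ℝ≥0∞} (hh : Measurable h) (a r : ℝ) :
    ∫⁻ t in Ioc a r, (∫⁻ s in Icc t r, h s) ^ p * ENNReal.ofReal (Real.exp (m * t)) ≤
      ENNReal.ofReal (p / m) ^ p * ∫⁻ s in Ioc a r, h s ^ p * ENNReal.ofReal (Real.exp (m * s)) := by
  have hp0 : 0 < p := by linarith
  -- With kp = m, the p-th power of e^{k(s-t)} turns e^{mt} into exactly e^{ms}.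
  set k := m / p with hk
  have hk0 : 0 < k := by positivity
  have hkp : 1 / k = p / m := by rw [hk]; field_simp
  set w : ℝ → ℝ → ℝ≥0∞ := fun t s => ENNReal.ofReal (Real.exp (-(k * (s - t)))) with hw
  set c := ENNReal.ofReal (p / m) with hc
  have step (t : ℝ) : (∫⁻ s in Icc t r, h s) ^ p * ENNReal.ofReal (Real.exp (m * t)) ≤
      c ^ (p - 1) *
        ∫⁻ s in Ioc t r, w t s * (h s ^ p * ENNReal.ofReal (Real.exp (m * s))) := by
    have e1 : ∫⁻ s in Icc t r, h s =
        ∫⁻ s in Ioc t r, w t s * (ENNReal.ofReal (Real.exp (k * (s - t))) * h s) := by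
      rw [restrict_Ioc_eq_restrict_Icc]
      refine lintegral_congr fun s => ?_
      rw [hw, ← mul_assoc, ← ENNReal.ofReal_mul (by positivity), ← Real.exp_add]
      simp
    rw [e1]
    refine (mul_le_mul_left (rpow_lintegral_mul_le hp (by fun_prop) (by fun_prop)) _).trans ?_
    rw [mul_assoc]
    refine mul_le_mul' (ENNReal.rpow_le_rpow ?_ (by linarith)) ?_
    · rw [hc, ← hkp, ← lintegral_exp_neg_mul_sub_Ioi hk0 t]
      exact lintegral_mono_set Ioc_subset_Ioi_self
    · rw [← lintegral_mul_const _ (by fun_prop)]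
      refine (lintegral_congr fun s => ?_).le
      rw [mul_assoc, ENNReal.mul_rpow_of_nonneg _ _ hp0.le,
        ENNReal.ofReal_rpow_of_pos (by positivity), mul_right_comm, ← Real.exp_mul,
        ← ENNReal.ofReal_mul (by positivity), ← Real.exp_add, mul_comm (ENNReal.ofReal _) (h s ^ p)]
      congr 4
      rw [hk]; field_simp; ring
  refine (lintegral_mono step).trans ?_
  have e2 : c ^ p = c ^ (p - 1) * c := by
    conv_rhs => rw [← ENNReal.rpow_one c, ← ENNReal.rpow_mul]
    rw [mul_comm (1:ℝ), ← ENNReal.rpow_add_of_nonneg _ _ (by linarith) (by linarith)]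
    simp
  set H : ℝ → ℝ≥0∞ := fun s => h s ^ p * ENNReal.ofReal (Real.exp (m * s)) with hH
  have hHm : Measurable H := by fun_prop
  -- The indicator of t ≤ s extends the triangle to a square, so that Tonelli applies.
  set F : ℝ → ℝ → ℝ≥0∞ := fun t s => (Iic s).indicator (fun t => w t s) t * H s with hF
  have hFm : Measurable (Function.uncurry F) := by
    have : Function.uncurry F = fun z : ℝ × ℝ =>
        ({z : ℝ × ℝ | z.1 ≤ z.2}.indicator (fun z => w z.1 z.2) z) * H z.2 := by
      ext ⟨t, s⟩
      simp [hF, indicator]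
    rw [this]
    refine Measurable.mul (Measurable.indicator (by fun_prop) ?_) (by fun_prop)
    exact measurableSet_le measurable_fst measurable_snd
  rw [lintegral_const_mul' _ _ (ENNReal.rpow_ne_top_of_nonneg (by linarith) (by simp [hc])),
    e2, mul_assoc]
  gcongr c ^ (p - 1) * ?_
  calc ∫⁻ t in Ioc a r, ∫⁻ s in Ioc t r, w t s * H s
      ≤ ∫⁻ t in Ioc a r, ∫⁻ s in Ioc a r, F t s := by
        refine setLIntegral_mono' measurableSet_Ioc fun t ht => ?_
        rw [← inter_eq_self_of_subset_left (Ioc_subset_Ioc_left (b := r) ht.1.le),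
          ← Measure.restrict_restrict measurableSet_Ioc]
        refine (setLIntegral_mono' measurableSet_Ioc fun s hs => ?_).trans
          (setLIntegral_le_lintegral _ _)
        simp [hF, indicator, hs.1.le]
    _ = ∫⁻ s in Ioc a r, ∫⁻ t in Ioc a r, F t s :=
        lintegral_lintegral_swap hFm.aemeasurable
    _ ≤ ∫⁻ s in Ioc a r, c * H s := by
        refine lintegral_mono fun s => ?_
        simp only [hF]
        have : Measurable fun t => w t s := by fun_prop
        rw [lintegral_mul_const _ (this.indicator measurableSet_Iic)]
        gcongr
        refine (setLIntegral_le_lintegral _ _).trans ?_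
        rw [lintegral_indicator measurableSet_Iic, lintegral_exp_neg_mul_sub_Iic hk0, hkp]
    _ = _ := lintegral_const_mul _ hHm

-- Here the weight decreases away from r, so Hardy's argument fails. On so short an interval it
-- varies by at most e^{1/2} ≤ 2 ≤ 2^p, a loss absorbed by the length bound 1/(2m); unweighted
-- Hölder suffices.
open Set in
theorem lintegral_rpow_lintegral_Icc_mul_exp_le_of_short {p m : ℝ} (hp : 1 ≤ p) (hm : 0 < m)
    {h : ℝ → ℝ≥0∞} (hh : Measurable h) {r b : ℝ} (hrb : r ≤ b) (hb : b - r ≤ 1 / (2 * m)) :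
    ∫⁻ t in Ioo r b, (∫⁻ s in Icc r t, h s) ^ p * ENNReal.ofReal (Real.exp (m * t)) ≤
      ENNReal.ofReal (p / m) ^ p * ∫⁻ s in Ioo r b, h s ^ p * ENNReal.ofReal (Real.exp (m * s)) := by
  have hp0 : 0 < p := by linarith
  set L := ENNReal.ofReal (b - r) with hL
  set I := ∫⁻ s in Ioo r b, h s ^ p * ENNReal.ofReal (Real.exp (m * s)) with hI
  have hvol : volume.restrict (Ioo r b) univ = L := by simp [hL]
  have step (t : ℝ) (ht : t ∈ Ioo r b) :
      (∫⁻ s in Icc r t, h s) ^ p * ENNReal.ofReal (Real.exp (m * t)) ≤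
      L ^ (p - 1) * (ENNReal.ofReal (Real.exp (1 / 2)) * I) := by
    have h1 : (∫⁻ s in Icc r t, h s) ^ p ≤ L ^ (p - 1) * ∫⁻ s in Ioo r b, h s ^ p := by
      have := rpow_lintegral_mul_le (ν := volume.restrict (Ioo r b)) hp
        (w := fun _ => 1) measurable_const hh
      simp only [one_mul, lintegral_one, hvol] at this
      refine le_trans (ENNReal.rpow_le_rpow ?_ hp0.le) this
      rw [restrict_Ioo_eq_restrict_Ico]
      have hsub : Icc r t ⊆ Ico r b := fun x hx => ⟨hx.1, hx.2.trans_lt ht.2⟩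
      exact lintegral_mono_set hsub
    refine (mul_le_mul_left h1 _).trans ?_
    rw [mul_assoc]
    refine mul_le_mul_right ?_ _
    rw [hI, ← lintegral_mul_const _ (by fun_prop), ← lintegral_const_mul _ (by fun_prop)]
    refine setLIntegral_mono' measurableSet_Ioo fun s hs => ?_
    rw [mul_left_comm, ← ENNReal.ofReal_mul (by positivity), ← Real.exp_add]
    refine mul_le_mul_right (ENNReal.ofReal_le_ofReal (Real.exp_le_exp.2 ?_)) _
    have h3 : m * (t - s) ≤ m * (1 / (2 * m)) :=
      mul_le_mul_of_nonneg_left (by linarith [ht.2, hs.1]) hm.le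
    have h4 : m * (1 / (2 * m)) = 1 / 2 := by field_simp
    linarith
  refine (setLIntegral_mono' measurableSet_Ioo step).trans ?_
  rw [setLIntegral_const, Real.volume_Ioo, ← hL, mul_right_comm, mul_comm, ]
  have hLp : L ^ (p - 1) * L = L ^ p := by
    conv_lhs => rw [← ENNReal.rpow_one L, ← ENNReal.rpow_mul]
    rw [one_mul, ← ENNReal.rpow_add_of_nonneg _ _ (by linarith) (by linarith)]
    simp
  rw [hLp, mul_comm, ← mul_assoc]
  gcongr ?_ * I
  rw [hL, ENNReal.ofReal_rpow_of_nonneg (by linarith) hp0.le,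
    ENNReal.ofReal_rpow_of_nonneg (by positivity) hp0.le, ← ENNReal.ofReal_mul (by positivity)]
  refine ENNReal.ofReal_le_ofReal ?_
  have hexp : Real.exp (1 / 2) ≤ 2 := by
    have h5 : Real.exp (1 / 2) * Real.exp (1 / 2) = Real.exp 1 := by rw [← Real.exp_add]; norm_num
    nlinarith [Real.exp_one_lt_d9, Real.exp_pos (1 / 2)]
  calc (b - r) ^ p * Real.exp (1 / 2) ≤ (1 / (2 * m)) ^ p * 2 ^ p := by
        have h6 : (2 : ℝ) ^ (1 : ℝ) ≤ 2 ^ p := Real.rpow_le_rpow_of_exponent_le one_le_two hp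
        rw [Real.rpow_one] at h6
        exact mul_le_mul (Real.rpow_le_rpow (by linarith) hb hp0.le) (hexp.trans h6)
          (by positivity) (by positivity)
    _ = (1 / m) ^ p := by
        rw [← Real.mul_rpow (by positivity) (by positivity)]; congr 1; field_simp
    _ ≤ (p / m) ^ p := by gcongr

open Set in
theorem lintegral_enorm_sub_rpow_mul_exp_le {p m : ℝ} (hp : 1 ≤ p) (hm : 0 < m) {a r b : ℝ}
    (har : a < r) (hrb : r < b) (hb : b - r ≤ 1 / (2 * m)) {u : ℝ → ℝ}
    (hu : ContDiffOn ℝ 1 u (Ioo a b)) :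
    ∫⁻ t in Ioo a b, ‖u t - u r‖ₑ ^ p * ENNReal.ofReal (Real.exp (m * t)) ≤
      ENNReal.ofReal (p / m) ^ p *
        ∫⁻ t in Ioo a b, ‖deriv u t‖ₑ ^ p * ENNReal.ofReal (Real.exp (m * t)) := by
  have hp0 : 0 < p := by linarith
  have hh : Measurable fun t => ‖deriv u t‖ₑ := (measurable_deriv u).enorm
  have hsplit : Ioo a b = Ioc a r ∪ Ioo r b := (Ioc_union_Ioo_eq_Ioo har.le hrb).symm
  have hdisj : Disjoint (Ioc a r) (Ioo r b) :=
    disjoint_left.2 fun x hx hx' => (hx.2.trans_lt hx'.1).false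
  have hL := lintegral_rpow_lintegral_Icc_mul_exp_le hp hm hh a r
  have hR := lintegral_rpow_lintegral_Icc_mul_exp_le_of_short hp hm hh hrb.le hb
  conv_lhs => rw [hsplit, lintegral_union measurableSet_Ioo hdisj]
  conv_rhs => rw [hsplit, lintegral_union measurableSet_Ioo hdisj, mul_add]
  refine add_le_add (le_trans ?_ hL) (le_trans ?_ hR)
  · refine setLIntegral_mono' measurableSet_Ioc fun t ht => ?_
    gcongr
    rw [← enorm_neg, neg_sub]
    exact enorm_sub_le_lintegral_deriv_of_contDiffOn_Icc
      (hu.mono fun x hx => ⟨ht.1.trans_le hx.1, hx.2.trans_lt hrb⟩) ht.2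
  · refine setLIntegral_mono' measurableSet_Ioo fun t ht => ?_
    gcongr
    exact enorm_sub_le_lintegral_deriv_of_contDiffOn_Icc
      (hu.mono fun x hx => ⟨har.trans_le hx.1, hx.2.trans_lt ht.2⟩) ht.1.le

/-! ### Choice of a good height -/

open Set in
theorem exists_height_mul_lintegral_exp_le {m R : ℝ} (hm : 0 < m) (hR : 0 < R) {g : ℝ → ℝ≥0∞}
    (hg : Measurable g) :
    ∃ r, 0 < r ∧ r < R ∧ R - r ≤ 1 / (2 * m) ∧
      g r * ∫⁻ t in Ioo 0 R, ENNReal.ofReal (Real.exp (m * t)) ≤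
        3 * ∫⁻ t in Ioo 0 R, g t * ENNReal.ofReal (Real.exp (m * t)) := by
  set a := max 0 (R - 1 / (2 * m)) with ha
  have h2m : 0 < 1 / (2 * m) := by positivity
  have haR : a < R := max_lt hR (by linarith)
  have h0a : 0 ≤ a := le_max_left _ _
  set E : ℝ → ℝ≥0∞ := fun t => ENNReal.ofReal (Real.exp (m * t)) with hE
  have hEm : Measurable E := by fun_prop
  -- The top slab carries at least a third of the weight, since 3(1 - e^{-1/2}) ≥ 1, that is,
  -- e^{1/2} ≥ 3/2.
  have hvol : ∫⁻ t in Ioo 0 R, E t ≤ 3 * ∫⁻ t in Ioo a R, E t := by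
    rcases le_total (R - 1 / (2 * m)) 0 with h | h
    · rw [ha, max_eq_left h]
      exact le_mul_of_one_le_left' (by norm_num)
    · have ha' : a = R - 1 / (2 * m) := by rw [ha, max_eq_right h]
      have hfin : ∫⁻ t in Iic a, E t ≠ ⊤ := by simp [hE, lintegral_exp_mul_Iic hm]
      have hd : Disjoint (Iic a) (Ioo a R) :=
        disjoint_left.2 fun x (hx : x ≤ a) hx' => (hx'.1.trans_le hx).false
      have h1 : ∫⁻ t in Iic R, E t = (∫⁻ t in Iic a, E t) + ∫⁻ t in Ioo a R, E t := by
        rw [← restrict_Iio_eq_restrict_Iic, ← lintegral_union measurableSet_Ioo hd,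
          Iic_union_Ioo_eq_Iio haR]
      have h2 : ∫⁻ t in Ioo a R, E t = (∫⁻ t in Iic R, E t) - ∫⁻ t in Iic a, E t := by
        rw [h1, ENNReal.add_sub_cancel_left hfin]
      have h3 : ∫⁻ t in Ioo 0 R, E t ≤ ∫⁻ t in Iic R, E t :=
        lintegral_mono_set fun x hx => hx.2.le
      refine h3.trans ?_
      rw [h2, hE, lintegral_exp_mul_Iic hm, lintegral_exp_mul_Iic hm,
        ← ENNReal.ofReal_sub _ (by positivity), ← ENNReal.ofReal_ofNat 3,
        ← ENNReal.ofReal_mul (by norm_num)]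
      refine ENNReal.ofReal_le_ofReal ?_
      have h4 : Real.exp (m * R) = Real.exp (m * a) * Real.exp (1 / 2) := by
        rw [← Real.exp_add, ha']; congr 1; field_simp; ring
      have h5 : 1 / 2 + 1 ≤ Real.exp (1 / 2) := Real.add_one_le_exp _
      rw [← sub_div, ← mul_div_assoc]
      gcongr
      nlinarith [Real.exp_pos (m * a)]
  obtain ⟨r, hr, hgr⟩ : ∃ r ∈ Ioo a R,
      g r * ∫⁻ t in Ioo a R, E t ≤ ∫⁻ t in Ioo a R, g t * E t := by
    by_contra! H
    have hfin : ∫⁻ t in Ioo a R, E t ≠ ⊤ :=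
      ((lintegral_mono_set fun x hx => hx.2.le).trans_lt
        (by simp [hE, lintegral_exp_mul_Iic hm] : ∫⁻ t in Iic R, E t < ⊤)).ne
    have hpos : ∫⁻ t in Ioo a R, E t ≠ 0 := by
      rw [Ne, lintegral_eq_zero_iff hEm, Filter.EventuallyEq, ae_iff]
      simp [hE, Real.exp_pos, haR]
    -- The negated claim at the midpoint of the slab already forces the integral to be finite.
    have hI : ∫⁻ t in Ioo a R, g t * E t ≠ ⊤ := (H _ (⟨by linarith [left_lt_add_div_two.2 haR],
      add_div_two_lt_right.2 haR⟩ : (a + R) / 2 ∈ Ioo a R)).ne_top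
    set I := ∫⁻ t in Ioo a R, g t * E t
    set V := ∫⁻ t in Ioo a R, E t
    have hlt : ∫⁻ t in Ioo a R, I / V * E t < ∫⁻ t in Ioo a R, g t * E t := by
      refine setLIntegral_strict_mono measurableSet_Ioo ?_ (by fun_prop) ?_ ?_
      · simp [haR]
      · rw [lintegral_const_mul _ hEm, ENNReal.div_mul_cancel hpos hfin]; exact hI
      · refine .of_forall fun t ht => ?_
        have : I / V < g t := by
          rw [ENNReal.div_lt_iff (.inl hpos) (.inl hfin)]; exact H t ht
        exact ENNReal.mul_lt_mul_left (by simp [hE, Real.exp_pos]) (by simp [hE]) this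
    rw [lintegral_const_mul _ hEm, ENNReal.div_mul_cancel hpos hfin] at hlt
    exact hlt.false
  refine ⟨r, h0a.trans_lt hr.1, hr.2, by linarith [hr.1, le_max_right 0 (R - 1 / (2 * m))], ?_⟩
  calc g r * ∫⁻ t in Ioo 0 R, E t ≤ g r * (3 * ∫⁻ t in Ioo a R, E t) := by gcongr
    _ = 3 * (g r * ∫⁻ t in Ioo a R, E t) := by ring
    _ ≤ 3 * ∫⁻ t in Ioo a R, g t * E t := by gcongr
    _ ≤ 3 * ∫⁻ t in Ioo 0 R, g t * E t := by gcongr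

/-! ### L^p norms as integrals of p-th powers -/

theorem eLpNorm_ofReal_rpow {α F : Type*} [MeasurableSpace α] [NormedAddCommGroup F] {p : ℝ}
    (hp : 0 < p) (f : α → F) (ν : Measure α) :
    eLpNorm f (ENNReal.ofReal p) ν ^ p = ∫⁻ x, ‖f x‖ₑ ^ p ∂ν := by
  rw [eLpNorm_eq_lintegral_rpow_enorm_toReal (by simpa using hp) (by simp),
    ENNReal.toReal_ofReal hp.le, ← ENNReal.rpow_mul, one_div, inv_mul_cancel₀ hp.ne',
    ENNReal.rpow_one]

theorem eLpNorm_le_mul_eLpNorm_iff {α β F G : Type*} [MeasurableSpace α] [MeasurableSpace β]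
    [NormedAddCommGroup F] [NormedAddCommGroup G] {p : ℝ} (hp : 0 < p) {f : α → F} {ν : Measure α}
    {g : β → G} {ν' : Measure β} {C : ℝ≥0∞} :
    eLpNorm f (ENNReal.ofReal p) ν ≤ C * eLpNorm g (ENNReal.ofReal p) ν' ↔
      ∫⁻ x, ‖f x‖ₑ ^ p ∂ν ≤ C ^ p * ∫⁻ x, ‖g x‖ₑ ^ p ∂ν' := by
  rw [← ENNReal.rpow_le_rpow_iff hp, ENNReal.mul_rpow_of_nonneg _ _ hp.le,
    eLpNorm_ofReal_rpow hp, eLpNorm_ofReal_rpow hp]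

/-! ### Poincaré inequality on the flat torus -/

instance Submodule.vaddInvariantMeasure {R E : Type*} [Ring R] [AddCommGroup E] [Module R E]
    [MeasurableSpace E] [MeasurableAdd E] (ν : Measure E) [ν.IsAddLeftInvariant]
    (Γ : Submodule R E) : VAddInvariantMeasure Γ E ν :=
  ⟨fun c s _ => measure_preimage_add ν (c : E) s⟩

theorem fderiv_vadd_of_periodic {E G : Type*} [NormedAddCommGroup E] [NormedSpace ℝ E] {Γ : Submodule ℤ E}
     [NormedAddCommGroup G] [NormedSpace ℝ G] {F : E → G}
    (hF : ∀ (γ : Γ) x, F (γ +ᵥ x) = F x) (γ : Γ) (x : E) :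
    fderiv ℝ F (γ +ᵥ x) = fderiv ℝ F x := by
  have h : (fun y => F ((γ : E) + y)) = F := funext fun y => hF γ y
  calc fderiv ℝ F ((γ : E) + x) = fderiv ℝ (fun y => F ((γ : E) + y)) x :=
        (fderiv_comp_add_left (γ : E)).symm
    _ = fderiv ℝ F x := by rw [h]

section Lattice

variable {E : Type*} [NormedAddCommGroup E] [NormedSpace ℝ E] [FiniteDimensional ℝ E]
  [MeasurableSpace E] [BorelSpace E] {ν : Measure E} [ν.IsAddHaarMeasure]
  {Γ : Submodule ℤ E} [Countable Γ] {P : Set E}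

/-- A translate of a fundamental domain is again one, and periodic functions have the same integral
over both. -/
theorem lintegral_fundamentalDomain_add_left (hP : IsAddFundamentalDomain Γ P ν) {φ : E → ℝ≥0∞}
    (hφ : ∀ (γ : Γ) x, φ (γ +ᵥ x) = φ x) (a : E) :
    ∫⁻ x in P, φ (a + x) ∂ν = ∫⁻ x in P, φ x ∂ν := by
  rw [(measurePreserving_add_left ν a).setLIntegral_comp_emb (measurableEmbedding_addLeft a)]
  exact (hP.vadd_of_comm a).setLIntegral_eq hP φ hφ

/-- Integrate the derivative along the segment from x to a + x and apply Hölder in the parameter; by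
translation invariance every point of the segment contributes the same energy. -/
theorem lintegral_enorm_add_sub_rpow_le (hP : IsAddFundamentalDomain Γ P ν) {F : E → ℝ}
    (hF : ∀ (γ : Γ) x, F (γ +ᵥ x) = F x) (hF1 : ContDiff ℝ 1 F) {p : ℝ} (hp : 1 ≤ p) (a : E) :
    ∫⁻ x in P, ‖F (a + x) - F x‖ₑ ^ p ∂ν ≤ ‖a‖ₑ ^ p * ∫⁻ x in P, ‖fderiv ℝ F x‖ₑ ^ p ∂ν := by
  have hp0 : 0 < p := by linarith
  have hpt (x : E) : ‖F (a + x) - F x‖ₑ ^ p ≤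
      ‖a‖ₑ ^ p * ∫⁻ s in Set.Icc (0 : ℝ) 1, ‖fderiv ℝ F (s • a + x)‖ₑ ^ p := by
    have hu : ContDiff ℝ 1 fun s : ℝ => F (s • a + x) := hF1.comp (by fun_prop)
    have h1 := enorm_sub_le_lintegral_deriv_of_contDiffOn_Icc hu.contDiffOn zero_le_one
    have hd (s : ℝ) : deriv (fun s : ℝ => F (s • a + x)) s = fderiv ℝ F (s • a + x) a := by
      have h2 : HasDerivAt (fun s : ℝ => s • a + x) a s := by
        simpa using ((hasDerivAt_id s).smul_const a).add_const x
      exact ((hF1.differentiable one_ne_zero _).hasFDerivAt.comp_hasDerivAt s h2).deriv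
    simp only [one_smul, zero_smul, zero_add, hd] at h1
    calc ‖F (a + x) - F x‖ₑ ^ p
        ≤ (∫⁻ s in Set.Icc (0 : ℝ) 1, ‖a‖ₑ * ‖fderiv ℝ F (s • a + x)‖ₑ) ^ p := by
          refine ENNReal.rpow_le_rpow (h1.trans (lintegral_mono fun s => ?_)) hp0.le
          rw [mul_comm]
          exact ContinuousLinearMap.le_opENorm _ _
      _ = ‖a‖ₑ ^ p * (∫⁻ s in Set.Icc (0 : ℝ) 1, 1 * ‖fderiv ℝ F (s • a + x)‖ₑ) ^ p := by
          rw [lintegral_const_mul' _ _ enorm_ne_top, ENNReal.mul_rpow_of_nonneg _ _ hp0.le]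
          simp
      _ ≤ _ := by
          gcongr
          refine (rpow_lintegral_mul_le hp measurable_const ?_).trans ?_
          · exact (by fun_prop : Continuous fun s : ℝ => fderiv ℝ F (s • a + x)).enorm.measurable
          · simp
  refine (lintegral_mono hpt).trans ?_
  rw [lintegral_const_mul' _ _ (by simp [hp0.le])]
  gcongr ‖a‖ₑ ^ p * ?_
  rw [lintegral_lintegral_swap]
  · have h3 (s : ℝ) : ∫⁻ x in P, ‖fderiv ℝ F (s • a + x)‖ₑ ^ p ∂ν =
        ∫⁻ x in P, ‖fderiv ℝ F x‖ₑ ^ p ∂ν :=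
      lintegral_fundamentalDomain_add_left hP (φ := fun x => ‖fderiv ℝ F x‖ₑ ^ p)
        (fun γ x => by simp only [fderiv_vadd_of_periodic hF]) (s • a)
    simp [h3]
  · refine Measurable.aemeasurable (Measurable.pow_const ?_ p)
    exact (by fun_prop : Continuous fun z : E × ℝ => fderiv ℝ F (z.2 • a + z.1)).enorm.measurable

theorem exists_lintegral_enorm_sub_rpow_le (hP : IsAddFundamentalDomain Γ P ν)
    (hPm : MeasurableSet P) (hPfin : ν P ≠ ⊤) {B : ℝ≥0∞} (hB : ∀ x ∈ P, ‖x‖ₑ ≤ B) {F : E → ℝ}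
    (hF : ∀ (γ : Γ) x, F (γ +ᵥ x) = F x) (hF1 : ContDiff ℝ 1 F) {p : ℝ} (hp : 1 ≤ p) :
    ∃ m : ℝ, ∫⁻ x in P, ‖F x - m‖ₑ ^ p ∂ν ≤ B ^ p * ∫⁻ x in P, ‖fderiv ℝ F x‖ₑ ^ p ∂ν := by
  have hp0 : 0 < p := by linarith
  have hFc : Continuous F := hF1.continuous
  set J := B ^ p * ∫⁻ x in P, ‖fderiv ℝ F x‖ₑ ^ p ∂ν with hJ
  have hP0 : ν P ≠ 0 := hP.measure_ne_zero (NeZero.ne ν)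
  have hm : Measurable fun z : E × E => ‖F (z.2 + z.1) - F z.1‖ₑ ^ p :=
    (by fun_prop : Continuous fun z : E × E => F (z.2 + z.1) - F z.1).enorm.measurable.pow_const p
  have hm' : Measurable fun z : E × E => ‖F z.2 - F z.1‖ₑ ^ p :=
    (by fun_prop : Continuous fun z : E × E => F z.2 - F z.1).enorm.measurable.pow_const p
  have hdouble : ∫⁻ x in P, ∫⁻ y in P, ‖F y - F x‖ₑ ^ p ∂ν ∂ν ≤ ν P * J := by
    have h1 (x : E) : ∫⁻ y in P, ‖F y - F x‖ₑ ^ p ∂ν = ∫⁻ y in P, ‖F (y + x) - F x‖ₑ ^ p ∂ν := by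
      simp_rw [add_comm _ x]
      exact (lintegral_fundamentalDomain_add_left hP (φ := fun y => ‖F y - F x‖ₑ ^ p)
        (fun γ y => by simp only [hF]) x).symm
    simp_rw [h1]
    -- After the swap the outer variable is the displacement a, which lies in P and so has norm at
    -- most B.
    rw [lintegral_lintegral_swap hm.aemeasurable, mul_comm, ← setLIntegral_const]
    refine setLIntegral_mono' hPm fun a ha => ?_
    exact (lintegral_enorm_add_sub_rpow_le hP hF hF1 hp a).trans
      (by rw [hJ]; gcongr; exact hB a ha)
  -- Some x does no worse than average; its value F x serves as the constant.
  obtain ⟨x, -, hx⟩ := exists_le_setLAverage hP0 hPfin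
    (hm'.lintegral_prod_right' (ν := ν.restrict P)).aemeasurable
  refine ⟨F x, hx.trans ?_⟩
  rw [setLAverage_eq]
  exact ENNReal.div_le_of_le_mul' hdouble

end Lattice

theorem torusLift_vadd {n : ℕ} {Γ : Submodule ℤ (EuclideanSpace ℝ (Fin n))}
    (f : (EuclideanSpace ℝ (Fin n) ⧸ Γ) → ℝ) (γ : Γ) (x : EuclideanSpace ℝ (Fin n)) :
    torusLift Γ f (γ +ᵥ x) = torusLift Γ f x := by
  unfold torusLift
  congr 1
  rw [Submodule.Quotient.eq]
  simp [Submodule.vadd_def]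

theorem norm_gradient {E : Type*} [NormedAddCommGroup E] [InnerProductSpace ℝ E] [CompleteSpace E]
    (F : E → ℝ) (x : E) : ‖gradient F x‖ = ‖fderiv ℝ F x‖ := by
  simp [gradient]

theorem enorm_norm_gradient {E : Type*} [NormedAddCommGroup E] [InnerProductSpace ℝ E]
    [CompleteSpace E] (F : E → ℝ) (x : E) : ‖‖gradient F x‖‖ₑ = ‖fderiv ℝ F x‖ₑ := by
  rw [norm_gradient, enorm_norm]

theorem torusPoincareConst_lt_top {n : ℕ} {Γ : Submodule ℤ (EuclideanSpace ℝ (Fin n))}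
    [DiscreteTopology Γ] [IsZLattice ℝ Γ] {D : Set (EuclideanSpace ℝ (Fin n))}
    (hD : IsAddFundamentalDomain Γ D volume) {p : ℝ} (hp : 1 ≤ p) :
    torusPoincareConst Γ D p < ⊤ := by
  have hp0 : 0 < p := by linarith
  let b := (Module.Free.chooseBasis ℤ Γ)
  have hP := ZLattice.isAddFundamentalDomain b (volume : Measure (EuclideanSpace ℝ (Fin n)))
  have hPb := ZSpan.fundamentalDomain_isBounded (b.ofZLatticeBasis ℝ)
  have hPm := ZSpan.fundamentalDomain_measurableSet (b.ofZLatticeBasis ℝ)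
  obtain ⟨B, hB⟩ := hPb.exists_norm_le
  refine (sInf_le (a := ENNReal.ofReal B) fun f hf => ?_).trans_lt ENNReal.ofReal_lt_top
  obtain ⟨m, hm⟩ := exists_lintegral_enorm_sub_rpow_le hP hPm hPb.measure_lt_top.ne
    (B := ENNReal.ofReal B)
    (fun x hx => by rw [← ofReal_norm]; exact ENNReal.ofReal_le_ofReal (hB x hx))
    (torusLift_vadd f) hf hp
  refine ⟨m, ?_⟩
  rw [eLpNorm_le_mul_eLpNorm_iff hp0]
  simp_rw [enorm_norm_gradient]
  -- D may be unbounded; periodicity moves both integrals to the bounded fundamental parallelepiped.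
  rwa [hD.setLIntegral_eq hP _ fun γ x => by rw [torusLift_vadd],
    hD.setLIntegral_eq hP _ fun γ x => by rw [fderiv_vadd_of_periodic (torusLift_vadd f)]]

/-! ### Vertical and horizontal parts of the Riemannian gradient -/

theorem abs_fderiv_le_expGradientNorm {n : ℕ} (μ : Fin n → ℝ)
    (F : ℝ × EuclideanSpace ℝ (Fin n) → ℝ) (z : ℝ × EuclideanSpace ℝ (Fin n)) :
    |fderiv ℝ F z (1, 0)| ≤ expGradientNorm μ F z := by
  refine Real.abs_le_sqrt ?_
  simp only [expMetric, expGradient, ← sq]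
  exact le_add_of_nonneg_right (Finset.sum_nonneg fun i _ => by positivity)

theorem norm_sq_eq_sum_apply_single {n : ℕ} (l : EuclideanSpace ℝ (Fin n) →L[ℝ] ℝ) :
    ‖l‖ ^ 2 = ∑ i, l (EuclideanSpace.single i 1) ^ 2 := by
  have h (i : Fin n) : (InnerProductSpace.toDual ℝ (EuclideanSpace ℝ (Fin n))).symm l i =
      l (EuclideanSpace.single i 1) := by
    rw [← InnerProductSpace.toDual_symm_apply (x := EuclideanSpace.single i (1 : ℝ)),
      EuclideanSpace.inner_single_right]
    simp
  rw [← (InnerProductSpace.toDual ℝ (EuclideanSpace ℝ (Fin n))).symm.norm_map l,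
    EuclideanSpace.norm_sq_eq]
  simp [h]

/-- The horizontal part of |∇F|² is ∑ e^{-2μ_i t} (∂_i F)², and each coefficient is at least
e^{-2MR}. -/
theorem norm_fderiv_comp_inr_le_expGradientNorm {n : ℕ} {μ : Fin n → ℝ} {M : ℝ}
    (hM0 : 0 ≤ M) (hM : ∀ i, μ i ≤ M) (F : ℝ × EuclideanSpace ℝ (Fin n) → ℝ)
    {z : ℝ × EuclideanSpace ℝ (Fin n)} {R : ℝ} (hz0 : 0 ≤ z.1) (hzR : z.1 ≤ R) :
    ‖(fderiv ℝ F z).comp (ContinuousLinearMap.inr ℝ ℝ (EuclideanSpace ℝ (Fin n)))‖ ≤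
      Real.exp (M * R) * expGradientNorm μ F z := by
  rw [← abs_of_nonneg (norm_nonneg _), mul_comm, ← div_le_iff₀ (by positivity)]
  refine Real.le_sqrt_of_sq_le ?_
  rw [div_pow, sq_abs, norm_sq_eq_sum_apply_single, Finset.sum_div]
  simp only [expMetric, expGradient]
  refine le_add_of_nonneg_of_le (mul_self_nonneg _) (Finset.sum_le_sum fun i _ => ?_)
  set d := fderiv ℝ F z (0, EuclideanSpace.single i 1)
  have h1 : Real.exp (2 * μ i * z.1) * Real.exp (-(2 * μ i * z.1)) = 1 := by
    rw [← Real.exp_add]; simp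
  have h2 : Real.exp (M * R) ^ 2 * Real.exp (-(2 * μ i * z.1)) ≥ 1 := by
    rw [← Real.exp_nat_mul, ← Real.exp_add, ge_iff_le, Real.one_le_exp_iff]
    have h3 : μ i * z.1 ≤ M * R :=
      (mul_le_mul_of_nonneg_right (hM i) hz0).trans (mul_le_mul_of_nonneg_left hzR hM0)
    push_cast
    linarith
  rw [div_le_iff₀ (by positivity)]
  have h4 : Real.exp (2 * μ i * z.1) * (Real.exp (-(2 * μ i * z.1)) * d *
      (Real.exp (-(2 * μ i * z.1)) * d)) = Real.exp (-(2 * μ i * z.1)) * d ^ 2 := by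
    linear_combination Real.exp (-(2 * μ i * z.1)) * d ^ 2 * h1
  rw [h4]
  change d ^ 2 ≤ _
  nlinarith [sq_nonneg d]

theorem lintegral_expVolume {n : ℕ} (μ : Fin n → ℝ) (R : ℝ) (D : Set (EuclideanSpace ℝ (Fin n)))
    (φ : ℝ × EuclideanSpace ℝ (Fin n) → ℝ≥0∞) :
    ∫⁻ z, φ z ∂expVolume μ R D =
      ∫⁻ z, φ z * ENNReal.ofReal (Real.exp ((∑ i, μ i) * z.1))
        ∂((volume.restrict (Set.Ioo 0 R)).prod (volume.restrict D)) := by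
  rw [expVolume, lintegral_withDensity_eq_lintegral_mul_non_measurable _ (by fun_prop) (by simp),
    Measure.prod_restrict, ← Measure.volume_eq_prod]
  simp only [Pi.mul_apply, mul_comm]

theorem measurable_expGradientNorm {n : ℕ} (μ : Fin n → ℝ)
    (F : ℝ × EuclideanSpace ℝ (Fin n) → ℝ) : Measurable (expGradientNorm μ F) := by
  have h (v : ℝ × EuclideanSpace ℝ (Fin n)) : Measurable fun z => fderiv ℝ F z v :=
    measurable_fderiv_apply_const ℝ F v
  unfold expGradientNorm expMetric expGradient
  simp only
  have h1 := h (1, 0)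
  refine Measurable.sqrt (.add (by fun_prop) (Finset.measurable_sum _ fun i _ => ?_))
  have h2 := h (0, EuclideanSpace.single i 1)
  fun_prop

/-! ### The two halves of the estimate on the ball -/

section Cylinder

variable {n : ℕ} {μ : Fin n → ℝ} {D : Set (EuclideanSpace ℝ (Fin n))} {p R r : ℝ}
  {F : ℝ × EuclideanSpace ℝ (Fin n) → ℝ}

theorem aestronglyMeasurable_expVolume {f : ℝ × EuclideanSpace ℝ (Fin n) → ℝ}
    (hf : ContinuousOn f (Set.Ioo 0 R ×ˢ Set.univ)) :
    AEStronglyMeasurable f (expVolume μ R D) :=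
  ((hf.aestronglyMeasurable (measurableSet_Ioo.prod .univ)).mono_measure
    (Measure.restrict_mono (Set.prod_mono_right (Set.subset_univ D)) le_rfl)).mono_ac
    (withDensity_absolutelyContinuous _ _)

theorem eLpNorm_sub_slice_le (hp : 1 ≤ p) (hm : 0 < ∑ i, μ i) (hr0 : 0 < r) (hrR : r < R)
    (hr : R - r ≤ 1 / (2 * ∑ i, μ i)) (hF : ContDiffOn ℝ 1 F (Set.Ioo 0 R ×ˢ Set.univ)) :
    eLpNorm (fun z => F z - F (r, z.2)) (ENNReal.ofReal p) (expVolume μ R D) ≤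
      ENNReal.ofReal (p / ∑ i, μ i) *
        eLpNorm (expGradientNorm μ F) (ENNReal.ofReal p) (expVolume μ R D) := by
  have hp0 : 0 < p := by linarith
  set m := ∑ i, μ i with hmdef
  set ν := (volume.restrict (Set.Ioo 0 R)).prod (volume.restrict D) with hν
  have hN := measurable_expGradientNorm μ F
  have hd : Measurable fun z => fderiv ℝ F z (1, 0) := measurable_fderiv_apply_const ℝ F _
  have hopen : IsOpen (Set.Ioo 0 R ×ˢ (Set.univ : Set (EuclideanSpace ℝ (Fin n)))) :=
    isOpen_Ioo.prod isOpen_univ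
  have hc : ContinuousOn (fun z => F z - F (r, z.2)) (Set.Ioo 0 R ×ˢ Set.univ) :=
    hF.continuousOn.sub (hF.continuousOn.comp (by fun_prop) fun z _ => ⟨⟨hr0, hrR⟩, trivial⟩)
  have hmeas : AEMeasurable (fun z => ‖F z - F (r, z.2)‖ₑ ^ p *
      ENNReal.ofReal (Real.exp (m * z.1))) ν := by
    refine AEMeasurable.mul (AEMeasurable.pow_const ?_ p) (by fun_prop)
    rw [hν, Measure.prod_restrict, ← Measure.volume_eq_prod]
    exact ((hc.aestronglyMeasurable (measurableSet_Ioo.prod .univ)).mono_measure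
      (Measure.restrict_mono (Set.prod_mono_right (Set.subset_univ D)) le_rfl)).enorm
  rw [eLpNorm_le_mul_eLpNorm_iff hp0, lintegral_expVolume, lintegral_expVolume,
    -- The torus variable goes outside, leaving the Hardy inequality on each vertical line.
    lintegral_prod_symm _ hmeas]
  calc _ ≤ ∫⁻ x in D, ENNReal.ofReal (p / m) ^ p * ∫⁻ t in Set.Ioo 0 R,
        ‖fderiv ℝ F (t, x) (1, 0)‖ₑ ^ p * ENNReal.ofReal (Real.exp (m * t)) := by
        refine lintegral_mono fun x => ?_
        have hu : ContDiffOn ℝ 1 (fun t => F (t, x)) (Set.Ioo 0 R) :=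
          hF.comp (by fun_prop) fun t ht => ⟨ht, trivial⟩
        refine (lintegral_enorm_sub_rpow_mul_exp_le hp hm hr0 hrR hr hu).trans_eq ?_
        congr 1
        refine setLIntegral_congr_fun measurableSet_Ioo fun t ht => ?_
        have h1 : HasDerivAt (fun t : ℝ => (t, x)) (1, 0) t :=
          (hasDerivAt_id t).prodMk (hasDerivAt_const t x)
        have h2 : DifferentiableAt ℝ F (t, x) :=
          (hF.differentiableOn one_ne_zero).differentiableAt (hopen.mem_nhds ⟨ht, trivial⟩)
        have h3 : deriv (fun t => F (t, x)) t = fderiv ℝ F (t, x) (1, 0) :=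
          (h2.hasFDerivAt.comp_hasDerivAt t h1).deriv
        simp only [h3]
    _ = ENNReal.ofReal (p / m) ^ p * ∫⁻ z, ‖fderiv ℝ F z (1, 0)‖ₑ ^ p *
          ENNReal.ofReal (Real.exp (m * z.1)) ∂ν := by
        rw [lintegral_const_mul' _ _ (by simp [hp0.le]), lintegral_prod_symm _ (by fun_prop)]
    _ ≤ _ := by
        gcongr with z
        refine enorm_le_iff_norm_le.2 ?_
        exact (abs_fderiv_le_expGradientNorm μ F z).trans (le_abs_self _)

theorem eLpNorm_slice_sub_le (hp : 1 ≤ p) {M : ℝ} (hM0 : 0 ≤ M) (hM : ∀ i, μ i ≤ M)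
    (hr0 : 0 < r) (hrR : r < R) (hF : ContDiffOn ℝ 1 F (Set.Ioo 0 R ×ˢ Set.univ)) {c : ℝ}
    {C : ℝ≥0∞}
    (hr : (∫⁻ x in D, ‖(fderiv ℝ F (r, x)).comp (.inr ℝ ℝ (EuclideanSpace ℝ (Fin n)))‖ₑ ^ p) *
        ∫⁻ t in Set.Ioo 0 R, ENNReal.ofReal (Real.exp ((∑ i, μ i) * t)) ≤
      3 * ∫⁻ t in Set.Ioo 0 R,
        (∫⁻ x in D, ‖(fderiv ℝ F (t, x)).comp (.inr ℝ ℝ (EuclideanSpace ℝ (Fin n)))‖ₑ ^ p) *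
          ENNReal.ofReal (Real.exp ((∑ i, μ i) * t)))
    (hC : eLpNorm (fun x => F (r, x) - c) (ENNReal.ofReal p) (volume.restrict D) ≤
      C * eLpNorm (fun x => ‖gradient (fun x => F (r, x)) x‖) (ENNReal.ofReal p)
        (volume.restrict D)) :
    eLpNorm (fun z : ℝ × EuclideanSpace ℝ (Fin n) => F (r, z.2) - c) (ENNReal.ofReal p)
        (expVolume μ R D) ≤
      ENNReal.ofReal (3 ^ (1 / p)) * C * ENNReal.ofReal (Real.exp (M * R)) *
        eLpNorm (expGradientNorm μ F) (ENNReal.ofReal p) (expVolume μ R D) := by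
  have hp0 : 0 < p := by linarith
  set m := ∑ i, μ i with hmdef
  have hN := measurable_expGradientNorm μ F
  have hopen : IsOpen (Set.Ioo 0 R ×ˢ (Set.univ : Set (EuclideanSpace ℝ (Fin n)))) :=
    isOpen_Ioo.prod isOpen_univ
  have hslice : Continuous fun x => F (r, x) :=
    continuousOn_univ.1 (hF.continuousOn.comp (by fun_prop) fun x _ => ⟨⟨hr0, hrR⟩, trivial⟩)
  have hfd (x : EuclideanSpace ℝ (Fin n)) : fderiv ℝ (fun x => F (r, x)) x =
      (fderiv ℝ F (r, x)).comp (.inr ℝ ℝ (EuclideanSpace ℝ (Fin n))) := by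
    have h1 : HasFDerivAt (fun x : EuclideanSpace ℝ (Fin n) => (r, x))
        (.inr ℝ ℝ (EuclideanSpace ℝ (Fin n))) x := hasFDerivAt_prodMk_right r x
    have h2 : DifferentiableAt ℝ F (r, x) := (hF.differentiableOn one_ne_zero).differentiableAt
      (hopen.mem_nhds ⟨⟨hr0, hrR⟩, trivial⟩)
    exact (h2.hasFDerivAt.comp x h1).fderiv
  rw [eLpNorm_le_mul_eLpNorm_iff hp0] at hC
  simp_rw [enorm_norm_gradient, hfd] at hC
  have hGm : Measurable fun z => ‖(fderiv ℝ F z).comp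
      (ContinuousLinearMap.inr ℝ ℝ (EuclideanSpace ℝ (Fin n)))‖ₑ := by
    have h1 : Continuous fun l : ℝ × EuclideanSpace ℝ (Fin n) →L[ℝ] ℝ =>
        ‖l.comp (ContinuousLinearMap.inr ℝ ℝ (EuclideanSpace ℝ (Fin n)))‖ₑ := by fun_prop
    exact h1.measurable.comp (measurable_fderiv ℝ F)
  set G := fun z => ‖(fderiv ℝ F z).comp
      (ContinuousLinearMap.inr ℝ ℝ (EuclideanSpace ℝ (Fin n)))‖ₑ with hG
  set E := fun t : ℝ => ENNReal.ofReal (Real.exp (m * t)) with hE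
  have hEm : Measurable E := by fun_prop
  have hmeas : Measurable fun z : ℝ × EuclideanSpace ℝ (Fin n) =>
      ‖F (r, z.2) - c‖ₑ ^ p * E z.1 :=
    (((hslice.comp continuous_snd).sub continuous_const).enorm.measurable.pow_const p).mul
      (by fun_prop)
  rw [eLpNorm_le_mul_eLpNorm_iff hp0, lintegral_expVolume, lintegral_expVolume,
    lintegral_prod _ hmeas.aemeasurable,
    lintegral_prod _ (by fun_prop : Measurable fun z => ‖expGradientNorm μ F z‖ₑ ^ p *
      ENNReal.ofReal (Real.exp (m * z.1))).aemeasurable]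
  have hconst : (ENNReal.ofReal (3 ^ (1 / p)) * C * ENNReal.ofReal (Real.exp (M * R))) ^ p =
      C ^ p * (3 * ENNReal.ofReal (Real.exp (M * R)) ^ p) := by
    rw [ENNReal.mul_rpow_of_nonneg _ _ hp0.le, ENNReal.mul_rpow_of_nonneg _ _ hp0.le,
      ENNReal.ofReal_rpow_of_pos (by positivity), ← Real.rpow_mul (by norm_num),
      one_div_mul_cancel hp0.ne', Real.rpow_one, ENNReal.ofReal_ofNat]
    ring
  rw [hconst]
  calc _ = (∫⁻ x in D, ‖F (r, x) - c‖ₑ ^ p) * ∫⁻ t in Set.Ioo 0 R, E t := by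
        rw [← lintegral_const_mul _ hEm]
        refine lintegral_congr fun t => ?_
        exact lintegral_mul_const' (E t) _ ENNReal.ofReal_ne_top
    _ ≤ C ^ p * (∫⁻ x in D, G (r, x) ^ p) * ∫⁻ t in Set.Ioo 0 R, E t := by gcongr
    _ ≤ C ^ p * (3 * ∫⁻ t in Set.Ioo 0 R, (∫⁻ x in D, G (t, x) ^ p) * E t) := by
        rw [mul_assoc]; gcongr
    _ ≤ C ^ p * (3 * ∫⁻ t in Set.Ioo 0 R, ENNReal.ofReal (Real.exp (M * R)) ^ p *
          ∫⁻ x in D, ‖expGradientNorm μ F (t, x)‖ₑ ^ p * E t) := by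
        refine mul_le_mul_right (mul_le_mul_right
          (setLIntegral_mono' measurableSet_Ioo fun t ht => ?_) _) _
        rw [lintegral_mul_const' _ _ (by simp [hE]), ← mul_assoc,
          ← lintegral_const_mul' _ _ (by simp [hp0.le])]
        gcongr with x
        rw [← ENNReal.mul_rpow_of_nonneg _ _ hp0.le]
        refine ENNReal.rpow_le_rpow ?_ hp0.le
        rw [← Real.enorm_of_nonneg (Real.exp_pos _).le, ← enorm_mul]
        refine enorm_le_iff_norm_le.2 ?_
        exact (norm_fderiv_comp_inr_le_expGradientNorm hM0 hM F ht.1.le ht.2.le).trans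
          (le_abs_self _)
    _ = _ := by
        rw [lintegral_const_mul' _ _ (by simp [hp0.le])]
        simp only [mul_assoc]
        rfl

end Cylinder

/-! ### Assembly -/

/-- Stated for any admissible C, because the infimum defining the torus constant is not known to be
attained. -/
theorem expBallPoincareConst_le {n : ℕ} {μ : Fin n → ℝ}
    {Γ : Submodule ℤ (EuclideanSpace ℝ (Fin n))} {D : Set (EuclideanSpace ℝ (Fin n))} {p R M : ℝ}
    (hm : 0 < ∑ i, μ i) (hM0 : 0 ≤ M) (hM : ∀ i, μ i ≤ M) (hp : 1 ≤ p) (hR : 0 < R) {C : ℝ≥0∞}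
    (hC : ∀ f : (EuclideanSpace ℝ (Fin n) ⧸ Γ) → ℝ, ContDiff ℝ 1 (torusLift Γ f) →
      ∃ m : ℝ, eLpNorm (fun x => torusLift Γ f x - m) (ENNReal.ofReal p) (volume.restrict D) ≤
        C * eLpNorm (fun x => ‖gradient (torusLift Γ f) x‖) (ENNReal.ofReal p)
          (volume.restrict D)) :
    expBallPoincareConst μ Γ D p R ≤ ENNReal.ofReal (p / ∑ i, μ i) +
      ENNReal.ofReal (3 ^ (1 / p)) * C * ENNReal.ofReal (Real.exp (M * R)) := by
  refine sInf_le fun f hf => ?_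
  set F := expLift Γ f with hF
  obtain ⟨r, hr0, hrR, hr, hgr⟩ := exists_height_mul_lintegral_exp_le hm hR
    (g := fun t => ∫⁻ x in D,
      ‖(fderiv ℝ F (t, x)).comp (.inr ℝ ℝ (EuclideanSpace ℝ (Fin n)))‖ₑ ^ p) <| by
    have h1 : Continuous fun l : ℝ × EuclideanSpace ℝ (Fin n) →L[ℝ] ℝ =>
        ‖l.comp (ContinuousLinearMap.inr ℝ ℝ (EuclideanSpace ℝ (Fin n)))‖ₑ := by fun_prop
    exact ((h1.measurable.comp (measurable_fderiv ℝ F)).pow_const p).lintegral_prod_right'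
  have hslice : ContDiff ℝ 1 fun x => F (r, x) :=
    contDiffOn_univ.1 (hf.comp (by fun_prop) fun x _ => ⟨⟨hr0, hrR⟩, trivial⟩)
  obtain ⟨c, hc⟩ := hC (fun q => f (r, q)) hslice
  refine ⟨c, ?_⟩
  have h1 := eLpNorm_sub_slice_le (D := D) hp hm hr0 hrR hr hf
  have h2 := eLpNorm_slice_sub_le hp hM0 hM hr0 hrR hf hgr hc
  have hm1 : AEStronglyMeasurable (fun z => F (r, z.2)) (expVolume μ R D) :=
    aestronglyMeasurable_expVolume (hslice.continuous.comp continuous_snd).continuousOn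
  have hm2 : AEStronglyMeasurable F (expVolume μ R D) :=
    aestronglyMeasurable_expVolume hf.continuousOn
  have h3 := eLpNorm_add_le (hm2.sub hm1) (hm1.sub (aestronglyMeasurable_const (b := c)))
    (ENNReal.one_le_ofReal.2 hp)
  have h4 : (F - fun z => F (r, z.2)) + ((fun z => F (r, z.2)) - fun _ => c) =
      fun z => F z - c := by ext z; simp
  rw [h4] at h3
  rw [add_mul]
  exact h3.trans (add_le_add h1 h2)

theorem mainTheorem3 :
    ∃ A : ℝ → ℝ, (∀ s : ℝ, 0 < s → 0 < A s) ∧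
      ∀ (n : ℕ) (hn : 0 < n) (μ : Fin n → ℝ), (∀ i, 0 < μ i) → Monotone μ →
      ∀ (Γ : Submodule ℤ (EuclideanSpace ℝ (Fin n))) [DiscreteTopology Γ] [IsZLattice ℝ Γ]
        (D : Set (EuclideanSpace ℝ (Fin n))), IsAddFundamentalDomain Γ D volume →
      ∀ p : ℝ, 1 ≤ p → ∀ R : ℝ, 0 < R →
        torusPoincareConst Γ D p < ⊤ ∧
        expBallPoincareConst μ Γ D p R ≤
          ENNReal.ofReal (p / ∑ i, μ i) +
            ENNReal.ofReal (A (∑ i, μ i) ^ (1 / p)) * torusPoincareConst Γ D p *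
              ENNReal.ofReal (Real.exp (μ ⟨n - 1, Nat.sub_one_lt_of_lt hn⟩ * R)) := by
  refine ⟨fun _ => 3, fun _ _ => by norm_num, ?_⟩
  intro n hn μ hμ hmono Γ _ _ D hD p hp R hR
  refine ⟨torusPoincareConst_lt_top hD hp, ?_⟩
  set M := μ ⟨n - 1, Nat.sub_one_lt_of_lt hn⟩ with hMdef
  have hm : 0 < ∑ i, μ i := Finset.sum_pos (fun i _ => hμ i) ⟨⟨0, hn⟩, Finset.mem_univ _⟩
  have hM : ∀ i, μ i ≤ M := fun i => hmono (Fin.mk_le_mk.2 (by omega))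
  set k := ENNReal.ofReal (3 ^ (1 / p)) * ENNReal.ofReal (Real.exp (M * R)) with hk
  have hk0 : k ≠ 0 := by
    simp only [hk, ne_eq, mul_eq_zero, ENNReal.ofReal_eq_zero, not_or, not_le]
    exact ⟨by positivity, by positivity⟩
  have hktop : k ≠ ⊤ := ENNReal.mul_ne_top ENNReal.ofReal_ne_top ENNReal.ofReal_ne_top
  -- Isolating the torus constant, by dividing by the nonzero finite k, reduces the bound to one for
  -- each admissible C.
  rw [mul_right_comm, ← hk, ← tsub_le_iff_left, ← ENNReal.div_le_iff' hk0 hktop]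
  refine le_sInf fun C hC => ?_
  rw [ENNReal.div_le_iff' hk0 hktop, tsub_le_iff_left, hk, mul_right_comm]
  exact expBallPoincareConst_le hm (hμ _).le hM hp hR hC
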